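/- Let $k$ be a field of characteristic $0$ and let $(R,\mathfrak m,k_R)$ be a (noetherian) regular local $k$-algebra of dimension $d$ whose residue field $k_R=R/\mathfrak m$ is algebraic over $k$. Assume that $R$ satisfies the weak Jacobian condition $(WJ)_k$: there are $k$-linear derivations $\partial_1,\dots,\partial_d$ of $R$ and elements $f_1,\dots,f_d\in\mathfrak m$ with $\det(\partial_i(f_j))\notin\mathfrak m$. Let $D_R=\bigcup_{m\ge 0}D_R^m\subset \operatorname{End}_k(R)$ be the ring of $k$-linear differential operators of $R$, where $D_R^0=R$ (acting by multiplication) and $D_R^{m+1}=\{P\in\operatorname{End}_k(R) : [P,r]\in D_R^m \text{ for all } r\in R\}$. For an ideal $I$ of $R$ let $D_R I$ be the left ideal of $D_R$ generated by $I$. 1. $D_R/D_R\mathfrak m$ is a simple left $D_R$-module, and $D_R/D_R\mathfrak m^{n+1}$ is a semisimple left $D_R$-module for every integer $n\ge 0$. 2. Let $x_1,\dots,x_d$ be any regular system of parameters of $R$ (that is, $d$ elements generating $\mathfrak m$). There are unique $k$-linear derivations $\partial_{x_1},\dots,\partial_{x_d}$ of $R$ with $\partial_{x_i}(x_j)=\delta_{ij}$.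 For $n\ge 0$ put $$Q_{n,d}=\prod_{i=1}^d(1+\partial_{x_i}x_i)_n\in D_R,\qquad (a)_n=a(a+1)\cdots(a+n-1),\quad (a)_0=1,$$ and write $X^\alpha=x_1^{\alpha_1}\cdots x_d^{\alpha_d}$ and $|\alpha|=\sum_i\alpha_i$ for $\alpha\in\mathbb N^d$. Then for every $n\ge 0$ there is a well-defined isomorphism of left $D_R$-modules $$\psi:\bigoplus_{j=0}^{n}\ \bigoplus_{|\alpha|=j} D_R/D_R\mathfrak m\ \longrightarrow\ D_R/D_R\mathfrak m^{n+1}$$ that sends the class of $P\in D_R$ in the summand with index $(j,\alpha)$ to the class of $P\,Q_{n-j,d}\,X^\alpha$. -/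

import Mathlib

open IsLocalRing

noncomputable section

namespace DiffOp

/-- Multiplication by `r`, as a `k`-linear endomorphism of `R`. -/
abbrev mulEnd (k : Type*) {R : Type*} [Field k] [CommRing R] [Algebra k R] (r : R) :
    Module.End k R :=
  LinearMap.mulLeft k r

/-- The `k`-linear differential operators of order at most `m` on `R`, inside `End_k(R)`:
those of order at most `0` are the multiplications by elements of `R`, and `P` has order at most
`m + 1` when every commutator `[P, r]` with `r` in `R` has order at most `m`. -/
def ofOrder (k R : Type*) [Field k] [CommRing R] [Algebra k R] : ℕ → Set (Module.End k R)
  | 0 => Set.range (mulEnd k (R := R))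
  | m + 1 => {P | ∀ r : R, P * mulEnd k r - mulEnd k r * P ∈ ofOrder k R m}

section Lemmas

variable {k R : Type*} [Field k] [CommRing R] [Algebra k R]

theorem comm_mulEnd (r s : R) : mulEnd k r * mulEnd k s - mulEnd k s * mulEnd k r = 0 := by
  ext x
  simp [mul_left_comm]

theorem zero_mem (m : ℕ) : (0 : Module.End k R) ∈ ofOrder k R m := by
  induction m with
  | zero => exact ⟨0, by ext; simp⟩
  | succ m ih => intro r; simpa using ih

theorem add_mem (m : ℕ) : ∀ {P Q : Module.End k R}, P ∈ ofOrder k R m → Q ∈ ofOrder k R m →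
    P + Q ∈ ofOrder k R m := by
  induction m with
  | zero =>
    rintro _ _ ⟨r, rfl⟩ ⟨s, rfl⟩
    exact ⟨r + s, by ext; simp [add_mul]⟩
  | succ m ih =>
    intro P Q hP hQ r
    have h := ih (hP r) (hQ r)
    have e : (P + Q) * mulEnd k r - mulEnd k r * (P + Q)
        = (P * mulEnd k r - mulEnd k r * P) + (Q * mulEnd k r - mulEnd k r * Q) := by
      simp only [add_mul, mul_add]
      abel
    rw [e]
    exact h

theorem mem_succ (m : ℕ) : ∀ {P : Module.End k R}, P ∈ ofOrder k R m →
    P ∈ ofOrder k R (m + 1) := by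
  induction m with
  | zero =>
    rintro _ ⟨r, rfl⟩ s
    rw [comm_mulEnd]
    exact zero_mem 0
  | succ m ih => exact fun hP r => ih (hP r)

theorem mem_of_le {m n : ℕ} (h : m ≤ n) {P : Module.End k R} (hP : P ∈ ofOrder k R m) :
    P ∈ ofOrder k R n := by
  induction h with
  | refl => exact hP
  | step _ ih => exact mem_succ _ ih

theorem mul_mem (s : ℕ) : ∀ {m n : ℕ}, m + n = s → ∀ {P Q : Module.End k R},
    P ∈ ofOrder k R m → Q ∈ ofOrder k R n → P * Q ∈ ofOrder k R s := by
  induction s with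
  | zero =>
    intro m n h P Q hP hQ
    obtain ⟨rfl, rfl⟩ : m = 0 ∧ n = 0 := by omega
    obtain ⟨r, rfl⟩ := hP
    obtain ⟨t, rfl⟩ := hQ
    exact ⟨r * t, by ext; simp⟩
  | succ s ih =>
    intro m n h P Q hP hQ r
    have e : P * Q * mulEnd k r - mulEnd k r * (P * Q)
        = P * (Q * mulEnd k r - mulEnd k r * Q) + (P * mulEnd k r - mulEnd k r * P) * Q := by
      simp only [mul_sub, sub_mul, mul_assoc]
      abel
    rw [e]
    refine add_mem s ?_ ?_
    · cases n with
      | zero =>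
        obtain ⟨t, rfl⟩ := hQ
        rw [comm_mulEnd, mul_zero]
        exact zero_mem s
      | succ n => exact ih (by omega) hP (hQ r)
    · cases m with
      | zero =>
        obtain ⟨t, rfl⟩ := hP
        rw [comm_mulEnd, zero_mul]
        exact zero_mem s
      | succ m => exact ih (by omega) (hP r) hQ

theorem derivation_mem (δ : Derivation k R R) : (δ : R →ₗ[k] R) ∈ ofOrder k R 1 := by
  intro r
  refine ⟨δ r, ?_⟩
  ext x
  simp [mul_comm]

end Lemmas

end DiffOp

/-- The ring of `k`-linear differential operators of `R`, the union over `m` of the operators of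
order at most `m`, as a subring of `End_k(R)`. -/
def diffOp (k R : Type*) [Field k] [CommRing R] [Algebra k R] : Subring (Module.End k R) where
  carrier := ⋃ m, DiffOp.ofOrder k R m
  mul_mem' := by
    intro P Q hP hQ
    obtain ⟨m, hm⟩ := Set.mem_iUnion.1 hP
    obtain ⟨n, hn⟩ := Set.mem_iUnion.1 hQ
    exact Set.mem_iUnion.2 ⟨m + n, DiffOp.mul_mem _ rfl hm hn⟩
  one_mem' := Set.mem_iUnion.2 ⟨0, 1, by ext; simp⟩
  add_mem' := by
    intro P Q hP hQ
    obtain ⟨m, hm⟩ := Set.mem_iUnion.1 hP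
    obtain ⟨n, hn⟩ := Set.mem_iUnion.1 hQ
    exact Set.mem_iUnion.2 ⟨max m n, DiffOp.add_mem _ (DiffOp.mem_of_le (le_max_left _ _) hm)
      (DiffOp.mem_of_le (le_max_right _ _) hn)⟩
  zero_mem' := Set.mem_iUnion.2 ⟨0, DiffOp.zero_mem 0⟩
  neg_mem' := by
    intro P hP
    obtain ⟨m, hm⟩ := Set.mem_iUnion.1 hP
    have h1 : (-1 : Module.End k R) ∈ DiffOp.ofOrder k R 0 := ⟨-1, by ext; simp⟩
    have h := DiffOp.mul_mem _ rfl h1 hm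
    have e : -P = -1 * P := by ext; simp
    rw [e]
    exact Set.mem_iUnion.2 ⟨_, h⟩

namespace DiffOp

/-- The inclusion of `R` in its ring of differential operators, by multiplication operators. -/
def ofRing (k R : Type*) [Field k] [CommRing R] [Algebra k R] : R →+* diffOp k R :=
  (Algebra.lmul k R).toRingHom.codRestrict (diffOp k R) fun r =>
    Set.mem_iUnion.2 ⟨0, r, by ext; simp⟩

/-- A `k`-linear derivation of `R`, as a differential operator. -/
def ofDer {k R : Type*} [Field k] [CommRing R] [Algebra k R] (δ : Derivation k R R) :
    diffOp k R :=
  ⟨(δ : R →ₗ[k] R), Set.mem_iUnion.2 ⟨1, derivation_mem δ⟩⟩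

/-- The left ideal `D_R I` generated by an ideal `I` of `R` in the ring of differential
operators. -/
def leftIdeal (k : Type*) {R : Type*} [Field k] [CommRing R] [Algebra k R] (I : Ideal R) :
    Submodule (diffOp k R) (diffOp k R) :=
  Submodule.span (diffOp k R) (ofRing k R '' (I : Set R))

/-- The operator `∏_{i=1}^d (1 + ∂_i x_i)_n`, where `(a)_n = a (a + 1) ⋯ (a + n - 1)`
and the factors are taken in the order `i = 1, …, d`. -/
def pochhammerOp {k R : Type*} [Field k] [CommRing R] [Algebra k R] {d : ℕ}
    (x : Fin d → R) (δ : Fin d → Derivation k R R) (n : ℕ) : diffOp k R :=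
  (List.ofFn fun i : Fin d =>
    (ascPochhammer (diffOp k R) n).eval (1 + ofDer (δ i) * ofRing k R (x i))).prod

/-- The weak Jacobian condition over `k` for a local `k`-algebra `R` of Krull dimension `n`: there
are `k`-linear derivations `∂_1, …, ∂_n` of `R` and elements `f_1, …, f_n` of the maximal ideal
such that `det (∂_i (f_j))` is not in the maximal ideal. -/
def WeakJacobian (k R : Type*) [Field k] [CommRing R] [IsLocalRing R] [Algebra k R] : Prop :=
  ∃ n : ℕ, ringKrullDim R = n ∧
    ∃ (δ : Fin n → Derivation k R R) (f : Fin n → R), (∀ j, f j ∈ maximalIdeal R) ∧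
      (Matrix.of fun i j => δ i (f j)).det ∉ maximalIdeal R

end DiffOp

end

/-! The weak Jacobian condition yields derivations `∂_i` dual to any regular system of parameters
`x`. They are unique, because a derivation killing every `x_i` vanishes: the residue field is
algebraic and separable over `k`, and the powers of `𝔪` intersect in zero. Consequently the order of
an operator is detected by its commutators with the `x_i` alone.

Simplicity rests on the operator `E(P) = ∑ ∂_i [P, x_i]`. On operators of order at most `m` it is
multiplication by `m` up to order at most `m - 1` (`euler_sub_mem_ofOrder`), and it is right
`R`-linear. In characteristic 0 this allows descent on the order, which shows both that `D𝔪` is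
proper and that it is maximal.

For the decomposition, two facts about `Q_m` suffice. First, `x_i Q_m` lies in `D x_i^{m+1}`, so
right multiplication by `Q_{n-j} X^α` with `|α| = j` carries `D𝔪` into `D𝔪^{n+1}`. Second, `Q_m ≡
(m!)^d` modulo `D𝔪`, so up to a unit this map has leading term `X^α` in `D𝔪^j / D𝔪^{j+1}`. Monomials
of degree `j` generate that quotient and are independent over `D/D𝔪`
(`mem_leftIdeal_of_sum_monomial_mem`), so `ψ` is bijective by a triangular argument. Semisimplicity
follows. -/

namespace DiffOp

/-! ### Derivations dual to a system of parameters. -/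

section Derivations

variable {k R : Type*} [Field k] [CommRing R] [Algebra k R]

theorem derivation_mem_pow_of_forall_generator {ι : Type*} {x : ι → R} (δ : Derivation k R R)
    (hδ : ∀ i, δ (x i) = 0) {J : Ideal R} (hJ : ∀ r, δ r ∈ J) {r : R}
    (hr : r ∈ Ideal.span (Set.range x)) : δ r ∈ Ideal.span (Set.range x) * J := by
  induction hr using Submodule.span_induction with
  | mem y hy => obtain ⟨i, rfl⟩ := hy; simp [hδ]
  | zero => simp
  | add y z _ _ hy hz => rw [map_add]; exact Ideal.add_mem _ hy hz
  | smul a y hy' hy =>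
    rw [smul_eq_mul, Derivation.leibniz, smul_eq_mul, smul_eq_mul]
    exact Ideal.add_mem _ (Ideal.mul_mem_left _ _ hy) (Ideal.mul_mem_mul hy' (hJ a))

variable [IsLocalRing R]

/-- The minimal polynomial of the residue of `r` works: it is separable in characteristic 0. -/
theorem exists_aeval_mem_isUnit_aeval_derivative [CharZero k] [Algebra.IsAlgebraic k (ResidueField R)]
    (r : R) : ∃ p : Polynomial k, Polynomial.aeval r p ∈ maximalIdeal R ∧
      IsUnit (Polynomial.aeval r (Polynomial.derivative p)) := by
  have hint : IsIntegral k (residue R r) := (Algebra.IsAlgebraic.isAlgebraic _).isIntegral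
  have hres : ∀ p : Polynomial k,
      Polynomial.aeval (residue R r) p = residue R (Polynomial.aeval r p) := fun p =>
    Polynomial.aeval_algebraMap_apply (A := R) (ResidueField R) r p
  refine ⟨minpoly k (residue R r), ?_, ?_⟩
  · rw [← residue_eq_zero_iff, ← hres, minpoly.aeval]
  · rw [← residue_ne_zero_iff_isUnit, ← hres]
    exact (minpoly.irreducible hint).separable.aeval_derivative_ne_zero (minpoly.aeval _ _)

/-- A `k`-derivation of a noetherian local ring, with residue field algebraic over `k`, vanishes
as soon as it kills generators of the maximal ideal. -/
theorem derivation_eq_zero [CharZero k] [IsNoetherianRing R]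
    [Algebra.IsAlgebraic k (ResidueField R)] {ι : Type*} {x : ι → R}
    (hx : Ideal.span (Set.range x) = maximalIdeal R) (δ : Derivation k R R)
    (hδ : ∀ i, δ (x i) = 0) : δ = 0 := by
  have key : ∀ (n : ℕ) (r : R), δ r ∈ maximalIdeal R ^ n := by
    intro n
    induction n with
    | zero => simp
    | succ n ih =>
      intro r
      -- Here `p'(r) δ(r) = δ(p(r))` lies in `𝔪 · 𝔪^n` and `p'(r)` is a unit, which gains one power
      -- of `𝔪`.
      obtain ⟨p, hp, hp'⟩ := exists_aeval_mem_isUnit_aeval_derivative (k := k) r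
      have h := derivation_mem_pow_of_forall_generator δ hδ ih (hx ▸ hp)
      rw [hx, ← pow_succ', Derivation.map_aeval, smul_eq_mul] at h
      exact (Ideal.unit_mul_mem_iff_mem _ hp').1 h
  ext r
  have h : δ r ∈ ⨅ n : ℕ, maximalIdeal R ^ n := by
    simpa only [Submodule.mem_iInf] using fun n => key n r
  rwa [Ideal.iInf_pow_eq_bot_of_isLocalRing _ (Ideal.IsPrime.ne_top inferInstance)] at h

/-- Write `f_j = ∑ a_{jl} x_l`. Terms containing `δ_i(a_{jl})` carry a factor `x_l`, so modulo `𝔪`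
the Jacobian matrix of `f` is that of `x` times a coefficient matrix. Hence the matrix `M` of the
`δ_i(x_l)` is invertible, and `M⁻¹` recombines the `δ_l` into dual derivations. -/
theorem WeakJacobian.exists_derivation (hWJ : WeakJacobian k R) {d : ℕ}
    (hd : ringKrullDim R = d) {x : Fin d → R} (hx : Ideal.span (Set.range x) = maximalIdeal R) :
    ∃ δ : Fin d → Derivation k R R, ∀ i j, δ i (x j) = if i = j then 1 else 0 := by
  obtain ⟨n, hn, δ, f, hf, hdet⟩ := hWJ
  obtain rfl : n = d := by rw [hn] at hd; exact_mod_cast hd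
  have hf' : ∀ j, ∃ c : Fin n → R, ∑ l, c l * x l = f j := fun j =>
    Ideal.mem_span_range_iff_exists_fun.1 (hx ▸ hf j)
  choose a ha using hf'
  have hxm : ∀ l, x l ∈ maximalIdeal R := fun l => hx ▸ Ideal.subset_span ⟨l, rfl⟩
  set M : Matrix (Fin n) (Fin n) R := Matrix.of fun i l => δ i (x l) with hM
  set A : Matrix (Fin n) (Fin n) R := Matrix.of fun l j => a j l with hA
  have hmap : (Matrix.of fun i j => δ i (f j)).map (residue R) = (M * A).map (residue R) := by
    ext i j
    simp only [Matrix.map_apply, Matrix.of_apply, Matrix.mul_apply, hM, hA]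
    rw [← ha j, map_sum, map_sum, map_sum]
    refine Finset.sum_congr rfl fun l _ => ?_
    rw [Derivation.leibniz, smul_eq_mul, smul_eq_mul, map_add, map_mul, map_mul, map_mul,
      (residue_eq_zero_iff _).2 (hxm l), zero_mul, add_zero, mul_comm]
  have hunit : IsUnit M.det := by
    rw [← residue_eq_zero_iff, RingHom.map_det, RingHom.mapMatrix_apply, hmap,
      ← RingHom.mapMatrix_apply, ← RingHom.map_det, Matrix.det_mul, map_mul] at hdet
    exact (residue_ne_zero_iff_isUnit _).1 (left_ne_zero_of_mul hdet)
  refine ⟨fun i => ∑ l, M⁻¹ i l • δ l, fun i j => ?_⟩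
  have h := congrFun (congrFun (Matrix.nonsing_inv_mul M hunit) i) j
  rw [Matrix.mul_apply, Matrix.one_apply] at h
  rw [← h]
  change Derivation.coeFnAddMonoidHom (∑ l, M⁻¹ i l • δ l) (x j) = _
  rw [map_sum, Finset.sum_apply]
  rfl

end Derivations

/-! ### Order of an operator, tested on parameters. -/

section Order

variable {k R : Type*} [Field k] [CommRing R] [Algebra k R]

/-- A differential operator of order at most `0` is the multiplication by its value at `1`. -/
theorem mem_ofOrder_zero_iff {P : diffOp k R} :
    (P : Module.End k R) ∈ ofOrder k R 0 ↔ ∃ r, P = ofRing k R r :=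
  ⟨fun ⟨r, hr⟩ => ⟨r, Subtype.ext hr.symm⟩, fun ⟨r, hr⟩ => ⟨r, by rw [hr]; rfl⟩⟩

theorem exists_mem_ofOrder (P : diffOp k R) : ∃ m, (P : Module.End k R) ∈ ofOrder k R m :=
  Set.mem_iUnion.1 P.2

theorem commutator_mem_ofOrder {m : ℕ} {P : diffOp k R}
    (hP : (P : Module.End k R) ∈ ofOrder k R (m + 1)) (r : R) :
    ((P * ofRing k R r - ofRing k R r * P : diffOp k R) : Module.End k R) ∈ ofOrder k R m :=
  hP r

theorem ofRing_mul_ofDer (r : R) (δ : Derivation k R R) :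
    ofRing k R r * ofDer δ = ofDer δ * ofRing k R r - ofRing k R (δ r) := by
  refine Subtype.ext (LinearMap.ext fun s => ?_)
  change r * δ s = δ (r * s) - δ r * s
  rw [Derivation.leibniz, smul_eq_mul, smul_eq_mul]
  ring

theorem ofRing_commute (r s : R) : Commute (ofRing k R r) (ofRing k R s) :=
  (Commute.all r s).map (ofRing k R)

/-- The commutators of an operator of order at most `1` are the values of a derivation. -/
theorem exists_derivation_of_commutator {P : diffOp k R}
    (hP : (P : Module.End k R) ∈ ofOrder k R 1) :
    ∃ δ : Derivation k R R, ∀ r,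
      P * ofRing k R r - ofRing k R r * P = ofRing k R (δ r) := by
  have h : ∀ r s, P.1 (r * s) - r * P.1 s = (P.1 r - r * P.1 1) * s := by
    intro r s
    obtain ⟨g, hg⟩ := hP r
    have h1 : g * s = P.1 (r * s) - r * P.1 s := LinearMap.congr_fun hg s
    have h2 : g * 1 = P.1 (r * 1) - r * P.1 1 := LinearMap.congr_fun hg 1
    rw [← h1, ← mul_one g, h2, mul_one]
  refine ⟨Derivation.mk' (P.1 - LinearMap.mulRight k (P.1 1)) fun a b => ?_, fun r => ?_⟩
  · have h1 := h a b
    change P.1 (a * b) - a * b * P.1 1 = a * (P.1 b - b * P.1 1) + b * (P.1 a - a * P.1 1)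
    linear_combination h1
  · refine Subtype.ext (LinearMap.ext fun s => ?_)
    exact h r s

/-- The Jacobi identity with `[A, B] = 0`. -/
theorem commutator_commutator (P A B : diffOp k R) (h : Commute A B) :
    (P * A - A * P) * B - B * (P * A - A * P) = (P * B - B * P) * A - A * (P * B - B * P) := by
  simp only [mul_sub, sub_mul, mul_assoc, h.eq]
  simp only [← mul_assoc, h.eq]
  abel

variable [CharZero k] [IsLocalRing R] [IsNoetherianRing R]
  [Algebra.IsAlgebraic k (ResidueField R)] {ι : Type*} {x : ι → R}

/-- Each `[P, r]` again commutes with the `x_j` and has smaller order, so by induction it has order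
0. Then `r ↦ [P, r]` is a derivation killing the `x_j`, hence zero. -/
theorem mem_ofOrder_zero_of_commute (hx : Ideal.span (Set.range x) = maximalIdeal R)
    {P : diffOp k R} (hP : ∀ j, Commute P (ofRing k R (x j))) :
    (P : Module.End k R) ∈ ofOrder k R 0 := by
  obtain ⟨m, hm⟩ := exists_mem_ofOrder P
  induction m generalizing P with
  | zero => exact hm
  | succ m ih =>
    have h1 : (P : Module.End k R) ∈ ofOrder k R 1 := fun r =>
      ih (P := P * ofRing k R r - ofRing k R r * P)
        (fun j => ((hP j).mul_left (ofRing_commute _ _)).sub_left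
          ((ofRing_commute _ _).mul_left (hP j))) (hm r)
    obtain ⟨δ, hδ⟩ := exists_derivation_of_commutator h1
    have h0 : δ = 0 := derivation_eq_zero hx δ fun j => by
      have := hδ (x j)
      rw [(hP j).eq, sub_self] at this
      have := congrArg (fun Q : diffOp k R => Q.1 1) this
      exact ((mul_one _).symm.trans this.symm)
    refine mem_ofOrder_zero_iff.2 ⟨P.1 1, Subtype.ext (LinearMap.ext fun r => ?_)⟩
    have := congrArg (fun Q : diffOp k R => Q.1 1) (hδ r)
    rw [h0] at this
    have h2 : P.1 (r * 1) - r * P.1 1 = 0 * 1 := this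
    change P.1 r = P.1 1 * r
    linear_combination h2 + congrArg P.1 (mul_one r).symm

theorem mem_ofOrder_succ_of_commutator (hx : Ideal.span (Set.range x) = maximalIdeal R) {m : ℕ}
    {P : diffOp k R} (hP : ∀ j, ((P * ofRing k R (x j) - ofRing k R (x j) * P : diffOp k R) :
      Module.End k R) ∈ ofOrder k R m) : (P : Module.End k R) ∈ ofOrder k R (m + 1) := by
  induction m generalizing P with
  | zero =>
    intro r
    refine mem_ofOrder_zero_of_commute (P := P * ofRing k R r - ofRing k R r * P) hx fun j => ?_
    rw [commute_iff_eq, ← sub_eq_zero, commutator_commutator _ _ _ (ofRing_commute _ _)]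
    obtain ⟨s, hs⟩ := mem_ofOrder_zero_iff.1 (hP j)
    rw [hs, (ofRing_commute s r).eq, sub_self]
  | succ m ih =>
    intro r
    refine ih (P := P * ofRing k R r - ofRing k R r * P) fun j => ?_
    rw [commutator_commutator _ _ _ (ofRing_commute _ _)]
    exact hP j r

end Order

/-! ### Left ideals generated by ideals of `R`. -/

section LeftIdeal

variable {k R : Type*} [Field k] [CommRing R] [Algebra k R]

theorem ofRing_injective : Function.Injective (ofRing k R) := fun r s h => by
  have : r * 1 = s * 1 := congrArg (fun Q : diffOp k R => Q.1 1) h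
  simpa using this

theorem ofRing_mem_leftIdeal {I : Ideal R} {r : R} (hr : r ∈ I) :
    ofRing k R r ∈ leftIdeal k I :=
  Submodule.subset_span ⟨r, hr, rfl⟩

theorem mul_mem_leftIdeal {I : Ideal R} (P : diffOp k R) {Q : diffOp k R}
    (hQ : Q ∈ leftIdeal k I) : P * Q ∈ leftIdeal k I :=
  Submodule.smul_mem _ P hQ

theorem leftIdeal_mono {I J : Ideal R} (h : I ≤ J) : leftIdeal k I ≤ leftIdeal k J :=
  Submodule.span_mono (Set.image_mono h)

theorem leftIdeal_span (S : Set R) :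
    leftIdeal k (Ideal.span S) = Submodule.span (diffOp k R) (ofRing k R '' S) := by
  refine le_antisymm (Submodule.span_le.2 ?_)
    (Submodule.span_mono (Set.image_mono Ideal.subset_span))
  rintro _ ⟨r, hr, rfl⟩
  induction hr using Submodule.span_induction with
  | mem y hy => exact Submodule.subset_span ⟨y, hy, rfl⟩
  | zero => rw [map_zero]; exact Submodule.zero_mem _
  | add y z _ _ hy hz => rw [map_add]; exact Submodule.add_mem _ hy hz
  | smul a y _ hy => rw [smul_eq_mul, map_mul]; exact Submodule.smul_mem _ _ hy

/-- Right multiplication by `Q` is left `D`-linear, so generators suffice. -/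
theorem mul_mem_of_mem_leftIdeal {S : Set R} {L : Submodule (diffOp k R) (diffOp k R)}
    {Q : diffOp k R} (hQ : ∀ r ∈ S, ofRing k R r * Q ∈ L) {P : diffOp k R}
    (hP : P ∈ leftIdeal k (Ideal.span S)) : P * Q ∈ L := by
  rw [leftIdeal_span] at hP
  induction hP using Submodule.span_induction with
  | mem y hy => obtain ⟨r, hr, rfl⟩ := hy; exact hQ r hr
  | zero => rw [zero_mul]; exact Submodule.zero_mem _
  | add y z _ _ hy hz => rw [add_mul]; exact Submodule.add_mem _ hy hz
  | smul a y _ hy => rw [smul_eq_mul, mul_assoc]; exact Submodule.smul_mem _ _ hy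

theorem mul_ofRing_mem_leftIdeal {I J : Ideal R} {P : diffOp k R} (hP : P ∈ leftIdeal k I)
    {r : R} (hr : r ∈ J) : P * ofRing k R r ∈ leftIdeal k (I * J) := by
  rw [← Ideal.span_eq I] at hP
  refine mul_mem_of_mem_leftIdeal (fun s hs => ?_) hP
  rw [← map_mul]
  exact ofRing_mem_leftIdeal (Ideal.mul_mem_mul hs hr)

theorem derivation_mem_pow (δ : Derivation k R R) (I : Ideal R) (n : ℕ) :
    ∀ {r : R}, r ∈ I ^ (n + 1) → δ r ∈ I ^ n := by
  induction n with
  | zero => simp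
  | succ n ih =>
    intro r hr
    rw [pow_succ] at hr
    refine Submodule.mul_induction_on hr (fun a ha b hb => ?_) fun a b ha hb => ?_
    · rw [Derivation.leibniz, smul_eq_mul, smul_eq_mul]
      refine Ideal.add_mem _ (Ideal.mul_mem_right _ _ ha) ?_
      rw [pow_succ']
      exact Ideal.mul_mem_mul hb (ih ha)
    · rw [map_add]
      exact Ideal.add_mem _ ha hb

/-- Since `r ∂ = ∂ r - ∂(r)`, right multiplication by a derivation costs only one power of `I`. -/
theorem mul_ofDer_mem_leftIdeal (δ : Derivation k R R) (I : Ideal R) (n : ℕ) {P : diffOp k R}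
    (hP : P ∈ leftIdeal k (I ^ (n + 1))) : P * ofDer δ ∈ leftIdeal k (I ^ n) := by
  rw [← Ideal.span_eq (I ^ (n + 1))] at hP
  refine mul_mem_of_mem_leftIdeal (fun r hr => ?_) hP
  rw [ofRing_mul_ofDer]
  exact Submodule.sub_mem _
    (mul_mem_leftIdeal _ (ofRing_mem_leftIdeal (Ideal.pow_le_pow_right (Nat.le_succ n) hr)))
    (ofRing_mem_leftIdeal (derivation_mem_pow δ I n hr))

theorem isUnit_natCast [CharZero k] {n : ℕ} (hn : n ≠ 0) : IsUnit (n : diffOp k R) := by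
  have h : IsUnit (n : k) := (Nat.cast_ne_zero.2 hn).isUnit
  simpa using h.map ((ofRing k R).comp (algebraMap k R))

theorem natCast_mul_mem_iff [CharZero k] {n : ℕ} (hn : n ≠ 0)
    {L : Submodule (diffOp k R) (diffOp k R)} {P : diffOp k R} :
    (n : diffOp k R) * P ∈ L ↔ P ∈ L := by
  obtain ⟨u, hu⟩ := isUnit_natCast (k := k) (R := R) hn
  refine ⟨fun h => ?_, fun h => Submodule.smul_mem L _ h⟩
  have := Submodule.smul_mem L (↑u⁻¹ : diffOp k R) h
  rwa [smul_eq_mul, ← hu, Units.inv_mul_cancel_left] at this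

end LeftIdeal

/-! ### The Euler operator and maximality of `D𝔪`. -/

section Euler

variable {k R : Type*} [Field k] [CommRing R] [Algebra k R] {ι : Type*} [Fintype ι]

/-- The right `R`-linear Euler operator `P ↦ ∑ ∂_i [P, x_i]` on differential operators. -/
noncomputable def euler (x : ι → R) (δ : ι → Derivation k R R) (P : diffOp k R) : diffOp k R :=
  ∑ i, ofDer (δ i) * (P * ofRing k R (x i) - ofRing k R (x i) * P)

variable {x : ι → R} {δ : ι → Derivation k R R}

theorem euler_mul_ofRing (P : diffOp k R) (r : R) :
    euler x δ (P * ofRing k R r) = euler x δ P * ofRing k R r := by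
  simp only [euler, Finset.sum_mul]
  refine Finset.sum_congr rfl fun i _ => ?_
  rw [mul_assoc P, (ofRing_commute r (x i)).eq]
  simp only [mul_assoc, sub_mul]

theorem euler_sum {κ : Type*} (s : Finset κ) (P : κ → diffOp k R) :
    euler x δ (∑ j ∈ s, P j) = ∑ j ∈ s, euler x δ (P j) := by
  simp only [euler, Finset.sum_mul, Finset.mul_sum, ← Finset.sum_sub_distrib]
  rw [Finset.sum_comm]

theorem euler_ofRing (r : R) : euler x δ (ofRing k R r) = 0 :=
  Finset.sum_eq_zero fun i _ => by rw [(ofRing_commute r (x i)).eq, sub_self, mul_zero]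

/-- The extra term comes from `[∂_i, x_j] = δ_ij`; elsewhere `x_j` passes through the sum by
`commutator_commutator`. -/
theorem commutator_euler [DecidableEq ι] (hδ : ∀ i j, δ i (x j) = if i = j then 1 else 0)
    (P : diffOp k R) (j : ι) :
    euler x δ P * ofRing k R (x j) - ofRing k R (x j) * euler x δ P =
      euler x δ (P * ofRing k R (x j) - ofRing k R (x j) * P) +
        (P * ofRing k R (x j) - ofRing k R (x j) * P) := by
  have h : ∀ i, ofDer (δ i) * (P * ofRing k R (x i) - ofRing k R (x i) * P) * ofRing k R (x j) -
      ofRing k R (x j) * (ofDer (δ i) * (P * ofRing k R (x i) - ofRing k R (x i) * P)) =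
      ofDer (δ i) * ((P * ofRing k R (x j) - ofRing k R (x j) * P) * ofRing k R (x i) -
        ofRing k R (x i) * (P * ofRing k R (x j) - ofRing k R (x j) * P)) +
      if i = j then P * ofRing k R (x j) - ofRing k R (x j) * P else 0 := by
    intro i
    rw [commutator_commutator _ _ _ (ofRing_commute (x j) (x i)), mul_assoc, ← mul_assoc
      (ofRing k R (x j)), ofRing_mul_ofDer, hδ]
    split_ifs with hij
    · subst hij
      rw [map_one]
      simp only [sub_mul, mul_sub, one_mul, mul_assoc]
      abel
    · rw [map_zero, sub_zero, add_zero, mul_assoc, ← mul_sub]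
  have h' := Finset.sum_congr (rfl : (Finset.univ : Finset ι) = _) fun i _ => h i
  rw [Finset.sum_sub_distrib, ← Finset.sum_mul, ← Finset.mul_sum, Finset.sum_add_distrib,
    Finset.sum_ite_eq' Finset.univ j, if_pos (Finset.mem_univ j)] at h'
  exact h'

variable [CharZero k] [IsLocalRing R] [IsNoetherianRing R]
  [Algebra.IsAlgebraic k (ResidueField R)] [DecidableEq ι]

theorem euler_sub_mem_ofOrder (hx : Ideal.span (Set.range x) = maximalIdeal R)
    (hδ : ∀ i j, δ i (x j) = if i = j then 1 else 0) {m : ℕ} {P : diffOp k R}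
    (hP : (P : Module.End k R) ∈ ofOrder k R (m + 1)) :
    ((euler x δ P - (m + 1 : ℕ) * P : diffOp k R) : Module.End k R) ∈ ofOrder k R m := by
  -- Bracketing with `x_j` turns `E - (n + 1)` into `E - n` applied to `[P, x_j]`, which matches the
  -- drop in order.
  have key : ∀ (n : ℕ) (P : diffOp k R) (j : ι),
      (euler x δ P - (n + 1 : ℕ) * P) * ofRing k R (x j) -
        ofRing k R (x j) * (euler x δ P - (n + 1 : ℕ) * P) =
      euler x δ (P * ofRing k R (x j) - ofRing k R (x j) * P) -
        n * (P * ofRing k R (x j) - ofRing k R (x j) * P) := by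
    intro n P j
    have h := commutator_euler hδ P j
    have hc := (Nat.cast_commute (n + 1) (ofRing k R (x j))).eq
    rw [sub_mul, mul_sub (ofRing k R (x j)), ← mul_assoc (ofRing k R (x j)), ← hc,
      sub_sub_sub_comm, h, Nat.cast_succ]
    simp only [add_mul, one_mul, mul_sub, mul_assoc]
    abel
  induction m generalizing P with
  | zero =>
    refine mem_ofOrder_zero_of_commute hx fun j => ?_
    obtain ⟨s, hs⟩ := mem_ofOrder_zero_iff.1 (commutator_mem_ofOrder hP (x j))
    rw [commute_iff_eq, ← sub_eq_zero, key, hs, euler_ofRing, Nat.cast_zero, zero_mul, sub_zero]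
  | succ m ih =>
    refine mem_ofOrder_succ_of_commutator hx fun j => ?_
    rw [key]
    exact ih (commutator_mem_ofOrder hP (x j))

/-- Apply `E - (m + 1)` to the relation. By right `R`-linearity it acts on the coefficients,
lowering their order, while the right side becomes `-(m + 1) s` because `E` kills `R`; and `m + 1`
is a unit. -/
theorem mem_maximalIdeal_of_sum_eq_ofRing (hx : Ideal.span (Set.range x) = maximalIdeal R)
    (hδ : ∀ i j, δ i (x j) = if i = j then 1 else 0) {m : ℕ} {P : ι → diffOp k R} {s : R}
    (hP : ∀ i, (P i : Module.End k R) ∈ ofOrder k R m)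
    (hs : ∑ i, P i * ofRing k R (x i) = ofRing k R s) : s ∈ maximalIdeal R := by
  induction m generalizing P s with
  | zero =>
    choose p hp using fun i => mem_ofOrder_zero_iff.1 (hP i)
    simp only [hp, ← map_mul, ← map_sum] at hs
    rw [← ofRing_injective hs, ← hx]
    exact Ideal.sum_mem _ fun i _ => Ideal.mul_mem_left _ _ (Ideal.subset_span ⟨i, rfl⟩)
  | succ m ih =>
    have h := ih (s := -((m + 1 : ℕ) * s))
      (fun i => euler_sub_mem_ofOrder hx hδ (hP i)) (by
      simp only [sub_mul, mul_assoc, ← euler_mul_ofRing, Finset.sum_sub_distrib, ← Finset.mul_sum,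
        ← euler_sum, hs, euler_ofRing, zero_sub, map_neg, map_mul, map_natCast])
    have hu : IsUnit ((m + 1 : ℕ) : R) := by
      have h : IsUnit ((m + 1 : ℕ) : k) := (Nat.cast_ne_zero.2 m.succ_ne_zero).isUnit
      simpa using h.map (algebraMap k R)
    rw [neg_mem_iff] at h
    exact (Ideal.unit_mul_mem_iff_mem _ hu).1 h

theorem leftIdeal_maximalIdeal_ne_top (hx : Ideal.span (Set.range x) = maximalIdeal R)
    (hδ : ∀ i j, δ i (x j) = if i = j then 1 else 0) : leftIdeal k (maximalIdeal R) ≠ ⊤ := by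
  intro h
  have h1 : (1 : diffOp k R) ∈ leftIdeal k (maximalIdeal R) := h ▸ Submodule.mem_top
  rw [← hx, leftIdeal_span, ← Set.range_comp, Submodule.mem_span_range_iff_exists_fun] at h1
  obtain ⟨P, hP⟩ := h1
  choose m hm using fun i => exists_mem_ofOrder (P i)
  refine (Ideal.ne_top_iff_one _).1 (Ideal.IsPrime.ne_top inferInstance)
    (mem_maximalIdeal_of_sum_eq_ofRing (m := Finset.univ.sup m) (P := P) hx hδ
      (fun i => mem_of_le (Finset.le_sup (Finset.mem_univ i)) (hm i)) ?_)
  rw [map_one, ← hP]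
  rfl

/-- Descent on the order of some `P` in `N` outside `D𝔪`. If some `[P, x_i]` is outside `D𝔪`, use
it. Otherwise `E(P)` is in `D𝔪`, and `E(P) - (m + 1) P` is an element of `N` of lower order, still
outside. At order 0 a unit of `R` remains. -/
theorem isCoatom_leftIdeal_maximalIdeal (hx : Ideal.span (Set.range x) = maximalIdeal R)
    (hδ : ∀ i j, δ i (x j) = if i = j then 1 else 0) :
    IsCoatom (leftIdeal k (maximalIdeal R)) := by
  refine ⟨leftIdeal_maximalIdeal_ne_top hx hδ, fun N hN => ?_⟩
  have hxm : ∀ i, x i ∈ maximalIdeal R := fun i => hx ▸ Ideal.subset_span ⟨i, rfl⟩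
  have key : ∀ (m : ℕ) (P : diffOp k R), (P : Module.End k R) ∈ ofOrder k R m → P ∈ N →
      P ∉ leftIdeal k (maximalIdeal R) → N = ⊤ := by
    intro m
    induction m with
    | zero =>
      intro P hm hPN hP
      obtain ⟨r, rfl⟩ := mem_ofOrder_zero_iff.1 hm
      have hr : IsUnit r := by
        by_contra hr
        exact hP (ofRing_mem_leftIdeal ((mem_maximalIdeal r).2 hr))
      exact Ideal.eq_top_of_isUnit_mem N hPN (hr.map _)
    | succ m ih =>
      intro P hm hPN hP
      have hC : ∀ i, P * ofRing k R (x i) - ofRing k R (x i) * P ∈ N := fun i =>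
        N.sub_mem (hN.le (mul_mem_leftIdeal _ (ofRing_mem_leftIdeal (hxm i))))
          (N.smul_mem _ hPN)
      by_cases h : ∀ i, P * ofRing k R (x i) - ofRing k R (x i) * P ∈
          leftIdeal k (maximalIdeal R)
      · have hE : euler x δ P ∈ leftIdeal k (maximalIdeal R) :=
          Submodule.sum_mem _ fun i _ => mul_mem_leftIdeal _ (h i)
        refine ih _ (euler_sub_mem_ofOrder hx hδ hm) (N.sub_mem (hN.le hE) (N.smul_mem _ hPN)) ?_
        rwa [Submodule.sub_mem_iff_right _ hE, natCast_mul_mem_iff m.succ_ne_zero]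
      · push Not at h
        obtain ⟨i, hi⟩ := h
        exact ih _ (commutator_mem_ofOrder hm (x i)) (hC i) hi
  obtain ⟨P, hPN, hP⟩ := Set.exists_of_ssubset hN
  obtain ⟨m, hm⟩ := exists_mem_ofOrder P
  exact key m P hm hPN hP

end Euler

/-! ### Monomials and their derivatives. -/

section Monomial

variable {R : Type*} [CommRing R]

theorem prod_pow_mem_pow {ι : Type*} [Fintype ι] {x : ι → R} {I : Ideal R}
    (hx : ∀ i, x i ∈ I) {α : ι → ℕ} {j : ℕ} (hα : ∑ i, α i = j) : ∏ i, x i ^ α i ∈ I ^ j := by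
  rw [← hα, ← Finset.prod_pow_eq_pow_sum]
  exact Ideal.prod_mem_prod fun i _ => Ideal.pow_mem_pow (hx i) _

theorem prod_pow_add_single {ι : Type*} [Fintype ι] [DecidableEq ι] (x : ι → R) (α : ι → ℕ)
    (i : ι) : ∏ l, x l ^ (α + Pi.single i 1 : ι → ℕ) l = (∏ l, x l ^ α l) * x i := by
  simp only [Pi.add_apply, pow_add, Finset.prod_mul_distrib]
  congr 1
  rw [Finset.prod_eq_single i (fun l _ hl => by rw [Pi.single_eq_of_ne hl, pow_zero])
    (fun h => absurd (Finset.mem_univ i) h), Pi.single_eq_same, pow_one]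

theorem span_pow_le_span_monomials {ι : Type*} [Fintype ι] (x : ι → R) (j : ℕ) :
    Ideal.span (Set.range x) ^ j ≤
      Ideal.span {r | ∃ α : ι → ℕ, ∑ i, α i = j ∧ ∏ i, x i ^ α i = r} := by
  classical
  induction j with
  | zero =>
    rw [pow_zero, Ideal.one_eq_top, top_le_iff, Ideal.eq_top_iff_one]
    exact Ideal.subset_span ⟨0, by simp, by simp⟩
  | succ j ih =>
    rw [pow_succ]
    refine (Ideal.mul_mono_left ih).trans ?_
    rw [Ideal.span_mul_span']
    refine Ideal.span_mono ?_
    rintro _ ⟨_, ⟨α, hα, rfl⟩, _, ⟨i, rfl⟩, rfl⟩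
    exact ⟨α + Pi.single i 1, by simp [Finset.sum_add_distrib, hα], prod_pow_add_single x α i⟩

/-- The truncated subtraction is harmless: when `α i = 0` the coefficient vanishes. -/
theorem derivation_prod_pow {k : Type*} [Field k] [Algebra k R] {ι : Type*} [Fintype ι]
    [DecidableEq ι] {x : ι → R} {i : ι} {δ : Derivation k R R}
    (hδ : ∀ j, δ (x j) = if i = j then 1 else 0) (α : ι → ℕ) :
    δ (∏ l, x l ^ α l) = α i * ∏ l, x l ^ (α - Pi.single i 1 : ι → ℕ) l := by
  have h0 : ∀ s : Finset ι, i ∉ s → δ (∏ l ∈ s, x l ^ α l) = 0 := by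
    intro s
    induction s using Finset.induction_on with
    | empty => simp
    | insert a s ha ih =>
      intro hi
      rw [Finset.mem_insert, not_or] at hi
      rw [Finset.prod_insert ha, Derivation.leibniz, ih hi.2, Derivation.leibniz_pow, hδ,
        if_neg hi.1]
      simp
  have h1 : ∏ l, x l ^ (α - Pi.single i 1 : ι → ℕ) l =
      x i ^ (α i - 1) * ∏ l ∈ Finset.univ.erase i, x l ^ α l := by
    rw [← Finset.mul_prod_erase Finset.univ _ (Finset.mem_univ i), Pi.sub_apply, Pi.single_eq_same]
    congr 1
    refine Finset.prod_congr rfl fun l hl => ?_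
    rw [Pi.sub_apply, Pi.single_eq_of_ne (Finset.ne_of_mem_erase hl), Nat.sub_zero]
  rw [h1, ← Finset.mul_prod_erase Finset.univ _ (Finset.mem_univ i), Derivation.leibniz,
    h0 _ (Finset.notMem_erase i _), Derivation.leibniz_pow, hδ, if_pos rfl]
  simp only [smul_eq_mul, mul_zero, mul_one, nsmul_eq_mul, zero_add]
  ring

end Monomial

/-! ### The operators `Q_m`. -/

section Pochhammer

variable {k R : Type*} [Field k] [CommRing R] [Algebra k R]

/-- Each factor raises the power by one, through `x^{m+1} (1 + ∂x + m) = ∂ x^{m+2}`; the witness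
built is `∂^m`. -/
theorem ofRing_mul_pochhammer_of_derivation_eq_one {δ : Derivation k R R} {x : R} (h : δ x = 1)
    (m : ℕ) : ∃ B, ofRing k R x * (ascPochhammer (diffOp k R) m).eval
      (1 + ofDer δ * ofRing k R x) = B * ofRing k R (x ^ (m + 1)) := by
  induction m with
  | zero => exact ⟨1, by simp⟩
  | succ m ih =>
    obtain ⟨B, hB⟩ := ih
    refine ⟨B * ofDer δ, ?_⟩
    have hd : δ (x ^ (m + 1)) = (m + 1 : ℕ) * x ^ m := by
      rw [Derivation.leibniz_pow, h]
      simp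
    have hc : ofRing k R (x ^ (m + 1)) * (1 + ofDer δ * ofRing k R x + m) =
        ofDer δ * ofRing k R (x ^ (m + 1 + 1)) := by
      have e : ofRing k R (x ^ (m + 1)) * (ofDer δ * ofRing k R x) =
          ofDer δ * ofRing k R (x ^ (m + 1 + 1)) - (m + 1 : ℕ) * ofRing k R (x ^ (m + 1)) := by
        rw [← mul_assoc, ofRing_mul_ofDer, hd, sub_mul, mul_assoc, ← map_mul, ← map_mul,
          ← pow_succ, mul_assoc, ← pow_succ, map_mul (ofRing k R), map_natCast]
      rw [mul_add, mul_add, mul_one, e, ← (Nat.cast_commute m (ofRing k R (x ^ (m + 1)))).eq,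
        Nat.cast_succ, add_mul, one_mul]
      abel
    rw [ascPochhammer_succ_eval, ← mul_assoc, hB, mul_assoc, hc, mul_assoc]

/-- Modulo `Dx` the last factor `1 + ∂x + m` acts from the right as `m + 1`. -/
theorem pochhammer_sub_factorial (δ : Derivation k R R) (x : R) (m : ℕ) :
    ∃ A, (ascPochhammer (diffOp k R) m).eval (1 + ofDer δ * ofRing k R x) -
      (m.factorial : ℕ) = A * ofRing k R x := by
  induction m with
  | zero => exact ⟨0, by simp⟩
  | succ m ih =>
    obtain ⟨A, hA⟩ := ih
    refine ⟨(ascPochhammer (diffOp k R) m).eval (1 + ofDer δ * ofRing k R x) * ofDer δ +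
      (m + 1 : ℕ) * A, ?_⟩
    rw [ascPochhammer_succ_eval, add_mul, mul_assoc ((m + 1 : ℕ) : diffOp k R), ← hA,
      Nat.factorial_succ, Nat.cast_mul, mul_sub ((m + 1 : ℕ) : diffOp k R), (Nat.cast_commute
      (m + 1) ((ascPochhammer (diffOp k R) m).eval (1 + ofDer δ * ofRing k R x))).eq,
      Nat.cast_succ]
    simp only [mul_add, mul_one, mul_assoc]
    abel

theorem commute_pochhammer {δ : Derivation k R R} (x : R) {y : R} (h : δ y = 0) (m : ℕ) :
    Commute (ofRing k R y)
      ((ascPochhammer (diffOp k R) m).eval (1 + ofDer δ * ofRing k R x)) := by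
  have hy : Commute (ofRing k R y) (ofDer δ) := by
    rw [commute_iff_eq, ofRing_mul_ofDer, h, map_zero, sub_zero]
  induction m with
  | zero => simp
  | succ m ih =>
    rw [ascPochhammer_succ_eval]
    exact ih.mul_right (((Commute.one_right _).add_right
      (hy.mul_right (ofRing_commute y x))).add_right (Nat.commute_cast _ _))

variable {d : ℕ} {x : Fin d → R} {δ : Fin d → Derivation k R R}

/-- Every factor of index other than `i` commutes with `x_i`, so only the `i`-th one matters; the
ordered product is split there. -/
theorem ofRing_mul_pochhammerOp (hδ : ∀ i j, δ i (x j) = if i = j then 1 else 0) (m : ℕ)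
    (i : Fin d) :
    ∃ B, ofRing k R (x i) * pochhammerOp x δ m = B * ofRing k R (x i ^ (m + 1)) := by
  obtain ⟨s, t, hst⟩ := List.append_of_mem (List.mem_finRange i)
  have hnd := List.nodup_finRange d
  rw [hst, List.nodup_append] at hnd
  have hs : i ∉ s := fun h => hnd.2.2 i h i List.mem_cons_self rfl
  have ht : i ∉ t := (List.nodup_cons.1 hnd.2.1).1
  have hcomm : ∀ l : List (Fin d), i ∉ l → ∀ n : ℕ, Commute (ofRing k R (x i ^ n))
      (l.map fun i => (ascPochhammer (diffOp k R) m).eval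
        (1 + ofDer (δ i) * ofRing k R (x i))).prod := by
    intro l hl n
    refine Commute.list_prod_right _ _ fun F hF => ?_
    obtain ⟨a, ha, rfl⟩ := List.mem_map.1 hF
    rw [map_pow]
    refine (commute_pochhammer _ ?_ m).pow_left n
    rw [hδ, if_neg]
    rintro rfl
    exact hl ha
  obtain ⟨B, hB⟩ := ofRing_mul_pochhammer_of_derivation_eq_one
    (δ := δ i) (x := x i) (by rw [hδ, if_pos rfl]) m
  have h1 := (hcomm s hs 1).eq
  rw [pow_one] at h1
  rw [pochhammerOp, List.ofFn_eq_map, hst, List.map_append, List.prod_append, List.map_cons,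
    List.prod_cons, ← mul_assoc, h1, mul_assoc, ← mul_assoc (ofRing k R (x i)), hB, mul_assoc B,
    (hcomm t ht (m + 1)).eq, ← mul_assoc, ← mul_assoc]
  exact ⟨_, rfl⟩

theorem pochhammerOp_sub_mem {I : Ideal R} (hx : ∀ i, x i ∈ I) (m : ℕ) :
    pochhammerOp x δ m - ((m.factorial ^ d : ℕ) : diffOp k R) ∈ leftIdeal k I := by
  have key : ∀ l : List (Fin d), (l.map fun i => (ascPochhammer (diffOp k R) m).eval
        (1 + ofDer (δ i) * ofRing k R (x i))).prod -
      ((m.factorial ^ l.length : ℕ) : diffOp k R) ∈ leftIdeal k I := by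
    intro l
    induction l with
    | nil => simp
    | cons a l ih =>
      obtain ⟨A, hA⟩ := pochhammer_sub_factorial (δ a) (x a) m
      have h1 := mul_mem_leftIdeal ((ascPochhammer (diffOp k R) m).eval
        (1 + ofDer (δ a) * ofRing k R (x a))) ih
      have h2 := mul_mem_leftIdeal ((m.factorial ^ l.length : ℕ) : diffOp k R)
        (hA ▸ mul_mem_leftIdeal A (ofRing_mem_leftIdeal (k := k) (hx a)))
      rw [(Nat.cast_commute _ _).eq, sub_mul] at h2
      have h3 := Submodule.add_mem _ h1 h2
      rw [mul_sub, sub_add_sub_cancel, ← Nat.cast_mul, ← pow_succ'] at h3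
      simpa using h3
  have := key (List.finRange d)
  rwa [List.length_finRange, ← List.ofFn_eq_map] at this

end Pochhammer

/-! ### Independence of monomials in the graded pieces. -/

section Independence

variable {k R : Type*} [Field k] [CommRing R] [Algebra k R] [CharZero k] {ι : Type*} [Fintype ι]
  [DecidableEq ι] {x : ι → R} {δ : ι → Derivation k R R}

/-- The classes of the monomials of degree `j` are independent in
`D I ^ j / D I ^ (j + 1)` over `D / D I`. -/
theorem mem_leftIdeal_of_sum_monomial_mem {I : Ideal R} (hx : ∀ i, x i ∈ I)
    (hδ : ∀ i j, δ i (x j) = if i = j then 1 else 0) {j : ℕ} (s : Finset (ι → ℕ))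
    (hs : ∀ α ∈ s, ∑ i, α i = j) (P : (ι → ℕ) → diffOp k R)
    (hP : ∑ α ∈ s, P α * ofRing k R (∏ i, x i ^ α i) ∈ leftIdeal k (I ^ (j + 1))) :
    ∀ α ∈ s, P α ∈ leftIdeal k I := by
  induction j generalizing s P with
  | zero =>
    intro α hα
    have h0 : ∀ β ∈ s, β = 0 := fun β hβ => by
      ext i
      exact Finset.sum_eq_zero_iff.1 (hs β hβ) i (Finset.mem_univ i)
    obtain rfl := h0 α hα
    rw [Finset.eq_singleton_iff_unique_mem.2 ⟨hα, h0⟩] at hP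
    simpa using hP
  | succ j ih =>
    intro α hα
    obtain ⟨i, hi⟩ : ∃ i, α i ≠ 0 := by
      by_contra! h
      have := hs α hα
      simp [h] at this
    have hsub : ∀ β : ι → ℕ, β i ≠ 0 → β - Pi.single i 1 + Pi.single i 1 = β := fun β hβ => by
      ext l
      by_cases hl : l = i
      · subst hl
        simp only [Pi.add_apply, Pi.sub_apply, Pi.single_eq_same]
        omega
      · simp [hl]
    -- Right multiplication by `∂_i` differentiates the relation: the terms `P_β ∂_i X^β` already
    -- lie in `D I^{j+1}`, leaving a relation among monomials of degree `j`.
    have h1 := mul_ofDer_mem_leftIdeal (δ i) I (j + 1) hP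
    have h2 : ∑ β ∈ s, P β * ofRing k R (δ i (∏ l, x l ^ β l)) ∈ leftIdeal k (I ^ (j + 1)) := by
      have e : ∑ β ∈ s, P β * ofRing k R (δ i (∏ l, x l ^ β l)) =
          ∑ β ∈ s, P β * ofDer (δ i) * ofRing k R (∏ l, x l ^ β l) -
          (∑ β ∈ s, P β * ofRing k R (∏ l, x l ^ β l)) * ofDer (δ i) := by
        rw [Finset.sum_mul, ← Finset.sum_sub_distrib]
        refine Finset.sum_congr rfl fun β _ => ?_
        rw [mul_assoc _ _ (ofDer (δ i)), ofRing_mul_ofDer, mul_sub, mul_assoc, sub_sub_cancel]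
      rw [e]
      refine Submodule.sub_mem _ (Submodule.sum_mem _ fun β hβ => mul_mem_leftIdeal _
        (ofRing_mem_leftIdeal ?_)) h1
      exact prod_pow_mem_pow hx (hs β hβ)
    -- Terms with `β i = 0` vanish and are dropped, since lowering the `i`-th exponent is injective
    -- only on the others.
    have h3 : ∑ β ∈ s with β i ≠ 0, P β * ofRing k R (δ i (∏ l, x l ^ β l)) ∈
        leftIdeal k (I ^ (j + 1)) := by
      rwa [Finset.sum_filter_of_ne]
      intro β _ hβ h0
      rw [derivation_prod_pow (hδ i), h0, Nat.cast_zero, zero_mul, map_zero, mul_zero] at hβ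
      exact hβ rfl
    have hinj : Set.InjOn (fun β : ι → ℕ => β - Pi.single i 1)
        (s.filter fun β => β i ≠ 0 : Finset (ι → ℕ)) := by
      intro β hβ γ hγ h
      rw [← hsub β (Finset.mem_filter.1 hβ).2, ← hsub γ (Finset.mem_filter.1 hγ).2]
      exact congrArg (· + Pi.single i 1) h
    have h4 := ih ((s.filter fun β => β i ≠ 0).image fun β => β - Pi.single i 1) (by
        intro γ hγ
        obtain ⟨β, hβ, rfl⟩ := Finset.mem_image.1 hγ
        rw [Finset.mem_filter] at hβ
        have h := hs β hβ.1
        rw [← hsub β hβ.2] at h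
        simp only [Pi.add_apply, Finset.sum_add_distrib, Finset.sum_pi_single',
          Finset.mem_univ, if_true] at h
        exact Nat.succ.inj h)
      (fun γ => ((γ i + 1 : ℕ) : diffOp k R) * P (γ + Pi.single i 1)) (by
        rw [Finset.sum_image hinj]
        convert h3 using 1
        refine Finset.sum_congr rfl fun β hβ => ?_
        rw [Finset.mem_filter] at hβ
        have h : (β - Pi.single i 1 : ι → ℕ) i + 1 = β i := by
          rw [Pi.sub_apply, Pi.single_eq_same]
          omega
        rw [derivation_prod_pow (hδ i), hsub β hβ.2, h, map_mul, map_natCast,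
          (Nat.cast_commute _ (P β)).eq, mul_assoc])
      (α - Pi.single i 1) (Finset.mem_image_of_mem _ (Finset.mem_filter.2 ⟨hα, hi⟩))
    rwa [hsub α hi, natCast_mul_mem_iff (Nat.succ_ne_zero _)] at h4

end Independence

/-! ### The decomposition of `D / D I^{n+1}`. -/

section Decomposition

variable {k R : Type*} [Field k] [CommRing R] [Algebra k R] {d : ℕ} {x : Fin d → R}
  {δ : Fin d → Derivation k R R} {I : Ideal R}

/-- Well-definedness of `ψ`: `x_i Q_{n-j} f` lies in `D x_i^{n-j+1} f`, and the exponents add up to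
`n + 1`. -/
theorem mul_pochhammerOp_mul_mem (hx : Ideal.span (Set.range x) = I)
    (hδ : ∀ i j, δ i (x j) = if i = j then 1 else 0) {n j : ℕ} (hj : j ≤ n) {f : R}
    (hf : f ∈ I ^ j) {P : diffOp k R} (hP : P ∈ leftIdeal k I) :
    P * (pochhammerOp x δ (n - j) * ofRing k R f) ∈ leftIdeal k (I ^ (n + 1)) := by
  rw [← hx] at hP
  refine mul_mem_of_mem_leftIdeal ?_ hP
  rintro _ ⟨i, rfl⟩
  obtain ⟨B, hB⟩ := ofRing_mul_pochhammerOp (k := k) hδ (n - j) i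
  rw [← mul_assoc, hB, mul_assoc, ← map_mul]
  refine mul_mem_leftIdeal _ (ofRing_mem_leftIdeal ?_)
  rw [show n + 1 = (n - j + 1) + j by omega, pow_add]
  exact Ideal.mul_mem_mul (Ideal.pow_mem_pow (hx ▸ Ideal.subset_span ⟨i, rfl⟩) _) hf

theorem pochhammerOp_mul_sub_mem (hx : ∀ i, x i ∈ I) (m : ℕ) {j : ℕ} {f : R} (hf : f ∈ I ^ j) :
    pochhammerOp x δ m * ofRing k R f - ((m.factorial ^ d : ℕ) : diffOp k R) * ofRing k R f ∈
      leftIdeal k (I ^ (j + 1)) := by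
  rw [← sub_mul, pow_succ']
  exact mul_ofRing_mem_leftIdeal (pochhammerOp_sub_mem hx m) hf

/-- The map of cyclic modules `D / D I → D / D I ^ (n + 1)` given by right multiplication by
`Q_{n-j} X^α`. -/
noncomputable def monomialMap (hx : Ideal.span (Set.range x) = I)
    (hδ : ∀ i j, δ i (x j) = if i = j then 1 else 0) {n j : ℕ} (hj : j ≤ n) (α : Fin d → ℕ)
    (hα : ∑ i, α i = j) :
    (diffOp k R ⧸ leftIdeal k I) →ₗ[diffOp k R] diffOp k R ⧸ leftIdeal k (I ^ (n + 1)) :=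
  Submodule.mapQ _ _ (LinearMap.toSpanSingleton (diffOp k R) (diffOp k R)
    (pochhammerOp x δ (n - j) * ofRing k R (∏ i, x i ^ α i))) fun _ hP =>
      mul_pochhammerOp_mul_mem hx hδ hj
        (prod_pow_mem_pow (fun i => hx ▸ Ideal.subset_span ⟨i, rfl⟩) hα) hP

/-- The direct sum of the maps `monomialMap` over all monomials of degree at most `n`. -/
noncomputable def monomialSum (hx : Ideal.span (Set.range x) = I)
    (hδ : ∀ i j, δ i (x j) = if i = j then 1 else 0) (n : ℕ) :
    (DirectSum (Fin (n + 1)) fun j => DirectSum {α : Fin d → ℕ // ∑ i, α i = (j : ℕ)} fun _ =>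
      diffOp k R ⧸ leftIdeal k I) →ₗ[diffOp k R] diffOp k R ⧸ leftIdeal k (I ^ (n + 1)) :=
  DirectSum.toModule (diffOp k R) _ _ fun j => DirectSum.toModule (diffOp k R) _ _ fun α =>
    monomialMap hx hδ (Nat.lt_succ_iff.1 j.2) α.1 α.2

theorem monomialSum_lof (hx : Ideal.span (Set.range x) = I)
    (hδ : ∀ i j, δ i (x j) = if i = j then 1 else 0) {n : ℕ} (j : Fin (n + 1))
    (α : {α : Fin d → ℕ // ∑ i, α i = (j : ℕ)}) (P : diffOp k R) :
    monomialSum hx hδ n (DirectSum.lof (diffOp k R) (Fin (n + 1)) (fun j =>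
          DirectSum {α : Fin d → ℕ // ∑ i, α i = (j : ℕ)} fun _ => diffOp k R ⧸ leftIdeal k I) j
        (DirectSum.lof (diffOp k R) {α : Fin d → ℕ // ∑ i, α i = (j : ℕ)}
          (fun _ => diffOp k R ⧸ leftIdeal k I) α (Submodule.Quotient.mk P))) =
      Submodule.Quotient.mk
        (P * (pochhammerOp x δ (n - (j : ℕ)) * ofRing k R (∏ i, x i ^ α.1 i))) := by
  rw [monomialSum, DirectSum.toModule_lof, DirectSum.toModule_lof]
  rfl

instance (j : ℕ) : Fintype {α : Fin d → ℕ // ∑ i, α i = j} :=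
  Fintype.subtype (Finset.Nat.antidiagonalTuple d j) fun _ => Finset.Nat.mem_antidiagonalTuple

theorem sum_lof_mk_eq {n : ℕ}
    (u : DirectSum (Fin (n + 1)) fun j => DirectSum {α : Fin d → ℕ // ∑ i, α i = (j : ℕ)} fun _ =>
      diffOp k R ⧸ leftIdeal k I)
    (P : ∀ j : Fin (n + 1), {α : Fin d → ℕ // ∑ i, α i = (j : ℕ)} → diffOp k R)
    (hP : ∀ j α, Submodule.Quotient.mk (P j α) = u j α) :
    ∑ j, DirectSum.lof (diffOp k R) (Fin (n + 1)) (fun j =>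
      DirectSum {α : Fin d → ℕ // ∑ i, α i = (j : ℕ)} fun _ => diffOp k R ⧸ leftIdeal k I) j
        (∑ α, DirectSum.lof (diffOp k R) {α : Fin d → ℕ // ∑ i, α i = (j : ℕ)}
          (fun _ => diffOp k R ⧸ leftIdeal k I) α (Submodule.Quotient.mk (P j α))) = u := by
  simp only [hP, DirectSum.lof_eq_of, DirectSum.sum_univ_of]

variable [CharZero k]

/-- Strong induction on the degree `j`, reading the relation modulo `D I^{j+1}`, where `Q_{n-j}`
becomes the unit `((n-j)!)^d` and independence of monomials applies. -/
theorem monomialSum_injective (hx : Ideal.span (Set.range x) = I)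
    (hδ : ∀ i j, δ i (x j) = if i = j then 1 else 0) (n : ℕ) :
    Function.Injective (monomialSum hx hδ n) := by
  have hxI : ∀ i, x i ∈ I := fun i => hx ▸ Ideal.subset_span ⟨i, rfl⟩
  intro u v huv
  choose A hA using fun (j : Fin (n + 1)) (α : {α : Fin d → ℕ // ∑ i, α i = (j : ℕ)}) =>
    Submodule.Quotient.mk_surjective _ (u j α)
  choose B hB using fun (j : Fin (n + 1)) (α : {α : Fin d → ℕ // ∑ i, α i = (j : ℕ)}) =>
    Submodule.Quotient.mk_surjective _ (v j α)
  have hu := sum_lof_mk_eq u A hA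
  have hv := sum_lof_mk_eq v B hB
  let P := fun (j : Fin (n + 1)) (α : {α : Fin d → ℕ // ∑ i, α i = (j : ℕ)}) => A j α - B j α
  let T : Fin (n + 1) → diffOp k R := fun j => ∑ α : {α : Fin d → ℕ // ∑ i, α i = (j : ℕ)},
    P j α * (pochhammerOp x δ (n - (j : ℕ)) * ofRing k R (∏ i, x i ^ α.1 i))
  have hT : ∑ j, T j ∈ leftIdeal k (I ^ (n + 1)) := by
    rw [← hu, ← hv] at huv
    simp only [map_sum, monomialSum_lof] at huv
    rw [← Submodule.Quotient.mk_eq_zero, ← sub_eq_zero.2 huv]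
    simp only [T, P, ← Submodule.mkQ_apply, ← map_sum, ← map_sub, sub_mul, Finset.sum_sub_distrib]
  have hmain : ∀ (m : ℕ) (j : Fin (n + 1)), (j : ℕ) = m → ∀ α, P j α ∈ leftIdeal k I := by
    intro m
    induction m using Nat.strong_induction_on with
    | _ m ih =>
    rintro j rfl α
    have hle : I ^ (n + 1) ≤ I ^ ((j : ℕ) + 1) := Ideal.pow_le_pow_right j.2
    have h1 : T j ∈ leftIdeal k (I ^ ((j : ℕ) + 1)) := by
      rw [← Finset.add_sum_erase _ _ (Finset.mem_univ j)] at hT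
      refine (Submodule.add_mem_iff_left _ (Submodule.sum_mem _ fun i hi => ?_)).1
        (leftIdeal_mono hle hT)
      refine Submodule.sum_mem _ fun β _ => ?_
      -- Lower degrees have coefficients already in `D I`, so they contribute to `D I^{n+1}`; higher
      -- degrees contain a monomial in `I^{j+1}`.
      rcases lt_or_gt_of_ne (Finset.ne_of_mem_erase hi) with hij | hij
      · exact leftIdeal_mono hle (mul_pochhammerOp_mul_mem hx hδ (Nat.lt_succ_iff.1 i.2)
          (prod_pow_mem_pow hxI β.2) (ih i hij i rfl β))
      · refine mul_mem_leftIdeal _ (mul_mem_leftIdeal _ (ofRing_mem_leftIdeal ?_))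
        exact Ideal.pow_le_pow_right (Nat.succ_le_of_lt hij) (prod_pow_mem_pow hxI β.2)
    have h2 : ∑ α : {α : Fin d → ℕ // ∑ i, α i = (j : ℕ)},
        (((n - (j : ℕ)).factorial ^ d : ℕ) * P j α) * ofRing k R (∏ i, x i ^ α.1 i) ∈
          leftIdeal k (I ^ ((j : ℕ) + 1)) := by
      have e := Submodule.sum_mem (leftIdeal k (I ^ ((j : ℕ) + 1)))
        (t := Finset.univ) fun (α : {α : Fin d → ℕ // ∑ i, α i = (j : ℕ)}) _ =>
        mul_mem_leftIdeal (P j α) (pochhammerOp_mul_sub_mem (δ := δ) hxI (n - (j : ℕ))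
          (prod_pow_mem_pow hxI α.2))
      simp only [mul_sub, Finset.sum_sub_distrib] at e
      rw [Submodule.sub_mem_iff_right _ h1] at e
      convert e using 2
      rw [(Nat.cast_commute _ (P j _)).eq, mul_assoc]
    -- Extension by zero off degree `j`, so that coefficients are indexed by all exponents.
    let P' : (Fin d → ℕ) → diffOp k R := fun β =>
      if h : ∑ i, β i = (j : ℕ) then ((n - (j : ℕ)).factorial ^ d : ℕ) * P j ⟨β, h⟩ else 0
    have hP' : ∀ β : {α : Fin d → ℕ // ∑ i, α i = (j : ℕ)},
        P' β.1 = ((n - (j : ℕ)).factorial ^ d : ℕ) * P j β := fun β => dif_pos β.2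
    have h3 := mem_leftIdeal_of_sum_monomial_mem hxI hδ (Finset.Nat.antidiagonalTuple d j)
      (fun β hβ => Finset.Nat.mem_antidiagonalTuple.1 hβ) P' (by
        rw [Finset.sum_subtype (p := fun α => ∑ i, α i = (j : ℕ)) _
          (fun _ => Finset.Nat.mem_antidiagonalTuple)
          (fun β => P' β * ofRing k R (∏ i, x i ^ β i))]
        simpa only [hP'] using h2) α.1 (Finset.Nat.mem_antidiagonalTuple.2 α.2)
    rwa [hP', natCast_mul_mem_iff (pow_ne_zero _ (Nat.factorial_ne_zero _))] at h3
  rw [← hu, ← hv]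
  refine Finset.sum_congr rfl fun j _ => congrArg _ (Finset.sum_congr rfl fun α _ => ?_)
  rw [(Submodule.Quotient.eq _).2 (hmain _ j rfl α)]

/-- Descending induction on `j`, from `j = n + 1` to `j = 0`: modulo `D I^{j+1}`, the image of the
`α`-summand's generator is a unit times `X^α`. -/
theorem monomialSum_surjective (hx : Ideal.span (Set.range x) = I)
    (hδ : ∀ i j, δ i (x j) = if i = j then 1 else 0) (n : ℕ) :
    Function.Surjective (monomialSum hx hδ n) := by
  have hxI : ∀ i, x i ∈ I := fun i => hx ▸ Ideal.subset_span ⟨i, rfl⟩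
  have key : ∀ j ≤ n + 1, leftIdeal k (I ^ j) ≤
      (LinearMap.range (monomialSum hx hδ n)).comap (Submodule.mkQ _) := by
    intro j hj
    induction hj using Nat.decreasingInduction with
    | self =>
      intro P hP
      rw [Submodule.mem_comap, Submodule.mkQ_apply, (Submodule.Quotient.mk_eq_zero _).2 hP]
      exact Submodule.zero_mem _
    | of_succ j hj ih =>
      have h := span_pow_le_span_monomials x j
      rw [hx] at h
      refine (leftIdeal_mono h).trans ?_
      rw [leftIdeal_span, Submodule.span_le]
      rintro _ ⟨_, ⟨α, hα, rfl⟩, rfl⟩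
      have h1 : pochhammerOp x δ (n - j) * ofRing k R (∏ i, x i ^ α i) ∈
          (LinearMap.range (monomialSum hx hδ n)).comap (Submodule.mkQ _) := by
        refine ⟨_, (monomialSum_lof hx hδ ⟨j, hj⟩ ⟨α, hα⟩ 1).trans ?_⟩
        rw [one_mul]
        rfl
      have h2 := ih (pochhammerOp_mul_sub_mem (δ := δ) hxI (n - j) (prod_pow_mem_pow hxI hα))
      rwa [Submodule.sub_mem_iff_right _ h1,
        natCast_mul_mem_iff (pow_ne_zero _ (Nat.factorial_ne_zero _))] at h2
  intro y
  obtain ⟨P, rfl⟩ := Submodule.Quotient.mk_surjective _ y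
  refine key 0 (Nat.zero_le _) ?_
  have h1 := ofRing_mem_leftIdeal (k := k) (show (1 : R) ∈ I ^ 0 by simp)
  rw [map_one] at h1
  simpa using mul_mem_leftIdeal P h1

/-- `D / D I ^ (n + 1)` is the direct sum of copies of `D / D I` indexed by the monomials of
degree at most `n`. -/
noncomputable def monomialEquiv (hx : Ideal.span (Set.range x) = I)
    (hδ : ∀ i j, δ i (x j) = if i = j then 1 else 0) (n : ℕ) :
    (DirectSum (Fin (n + 1)) fun j => DirectSum {α : Fin d → ℕ // ∑ i, α i = (j : ℕ)} fun _ =>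
      diffOp k R ⧸ leftIdeal k I) ≃ₗ[diffOp k R] diffOp k R ⧸ leftIdeal k (I ^ (n + 1)) :=
  LinearEquiv.ofBijective (monomialSum hx hδ n)
    ⟨monomialSum_injective hx hδ n, monomialSum_surjective hx hδ n⟩

/-- A sum of semisimple submodules is semisimple, so surjectivity of `monomialSum` suffices. -/
theorem isSemisimpleModule_quotient_pow
    [IsSemisimpleModule (diffOp k R) (diffOp k R ⧸ leftIdeal k I)]
    (hx : Ideal.span (Set.range x) = I) (hδ : ∀ i j, δ i (x j) = if i = j then 1 else 0) (n : ℕ) :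
    IsSemisimpleModule (diffOp k R) (diffOp k R ⧸ leftIdeal k (I ^ (n + 1))) := by
  refine isSemisimpleModule_of_isSemisimpleModule_submodule'
    (p := fun s : Σ j : Fin (n + 1), {α : Fin d → ℕ // ∑ i, α i = (j : ℕ)} =>
      LinearMap.range (monomialMap (k := k) hx hδ (Nat.lt_succ_iff.1 s.1.2) s.2.1 s.2.2))
    (fun _ => IsSemisimpleModule.range _) (eq_top_iff.2 fun y _ => ?_)
  obtain ⟨u, rfl⟩ := monomialSum_surjective hx hδ n y
  choose A hA using fun (j : Fin (n + 1)) (α : {α : Fin d → ℕ // ∑ i, α i = (j : ℕ)}) =>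
    Submodule.Quotient.mk_surjective _ (u j α)
  rw [← sum_lof_mk_eq u A hA]
  simp only [map_sum, monomialSum_lof]
  exact Submodule.sum_mem _ fun j _ => Submodule.sum_mem _ fun α _ =>
    Submodule.mem_iSup_of_mem ⟨j, α⟩ ⟨Submodule.Quotient.mk (A j α), rfl⟩

end Decomposition

theorem exists_regular_parameters {R : Type*} [CommRing R] [IsRegularLocalRing R] {d : ℕ}
    (hd : ringKrullDim R = d) :
    ∃ x : Fin d → R, Ideal.span (Set.range x) = maximalIdeal R := by
  have hfg : (maximalIdeal R).FG := IsNoetherian.noetherian _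
  have hcard : (Submodule.generators (maximalIdeal R)).ncard = d := by
    have h := IsRegularLocalRing.spanFinrank_maximalIdeal (R := R)
    rw [Submodule.FG.generators_ncard hfg]
    rw [hd] at h
    exact_mod_cast h
  have : Finite (Submodule.generators (maximalIdeal R)) := Submodule.FG.finite_generators hfg
  let e := Finite.equivFinOfCardEq hcard
  refine ⟨fun i => (e.symm i : R), ?_⟩
  rw [show Set.range (fun i => (e.symm i : R)) = Submodule.generators (maximalIdeal R) by
    rw [← Function.comp_def, Set.range_comp, e.symm.surjective.range_eq, Set.image_univ,
      Subtype.range_coe]]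
  exact Submodule.span_generators _

end DiffOp

theorem theorem2p3 {k R : Type*} [Field k] [CharZero k] [CommRing R] [IsRegularLocalRing R]
    [Algebra k R] [Algebra.IsAlgebraic k (ResidueField R)] (hWJ : DiffOp.WeakJacobian k R)
    (d : ℕ) (hd : ringKrullDim R = d) :
    IsSimpleModule (diffOp k R) (diffOp k R ⧸ DiffOp.leftIdeal k (maximalIdeal R)) ∧
    (∀ n : ℕ, IsSemisimpleModule (diffOp k R)
      (diffOp k R ⧸ DiffOp.leftIdeal k (maximalIdeal R ^ (n + 1)))) ∧
    ∀ x : Fin d → R, Ideal.span (Set.range x) = maximalIdeal R →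
      ∃ δ : Fin d → Derivation k R R,
        (∀ i j, δ i (x j) = if i = j then 1 else 0) ∧
        (∀ δ' : Fin d → Derivation k R R,
          (∀ i j, δ' i (x j) = if i = j then 1 else 0) → δ' = δ) ∧
        ∀ n : ℕ,
          ∃ ψ : (DirectSum (Fin (n + 1)) fun j =>
                DirectSum {α : Fin d → ℕ // ∑ i, α i = (j : ℕ)} fun _ =>
                  diffOp k R ⧸ DiffOp.leftIdeal k (maximalIdeal R)) ≃ₗ[diffOp k R]
              (diffOp k R ⧸ DiffOp.leftIdeal k (maximalIdeal R ^ (n + 1))),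
            ∀ (j : Fin (n + 1)) (α : {α : Fin d → ℕ // ∑ i, α i = (j : ℕ)}) (P : diffOp k R),
              ψ (DirectSum.lof (diffOp k R) (Fin (n + 1)) (fun j =>
                    DirectSum {α : Fin d → ℕ // ∑ i, α i = (j : ℕ)} fun _ =>
                      diffOp k R ⧸ DiffOp.leftIdeal k (maximalIdeal R)) j
                  (DirectSum.lof (diffOp k R) {α : Fin d → ℕ // ∑ i, α i = (j : ℕ)} (fun _ =>
                      diffOp k R ⧸ DiffOp.leftIdeal k (maximalIdeal R)) α
                    (Submodule.Quotient.mk P))) =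
                Submodule.Quotient.mk
                  (P * DiffOp.pochhammerOp x δ (n - (j : ℕ)) *
                    DiffOp.ofRing k R (∏ i, x i ^ α.1 i)) := by
  obtain ⟨x₀, hx₀⟩ := DiffOp.exists_regular_parameters hd
  obtain ⟨δ₀, hδ₀⟩ := hWJ.exists_derivation hd hx₀
  have hsimple : IsSimpleModule (diffOp k R) (diffOp k R ⧸ DiffOp.leftIdeal k (maximalIdeal R)) :=
    isSimpleModule_iff_isCoatom.2 (DiffOp.isCoatom_leftIdeal_maximalIdeal hx₀ hδ₀)
  refine ⟨hsimple, fun n => ?_, fun x hx => ?_⟩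
  · exact DiffOp.isSemisimpleModule_quotient_pow hx₀ hδ₀ n
  · obtain ⟨δ, hδ⟩ := hWJ.exists_derivation hd hx
    refine ⟨δ, hδ, fun δ' hδ' => funext fun i => ?_, fun n => ?_⟩
    · refine sub_eq_zero.1 (DiffOp.derivation_eq_zero hx (δ' i - δ i) fun j => ?_)
      rw [Derivation.sub_apply, hδ, hδ', sub_self]
    · refine ⟨DiffOp.monomialEquiv hx hδ n, fun j α P => ?_⟩
      rw [mul_assoc]
      exact DiffOp.monomialSum_lof hx hδ j α P
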